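/- Let $N\ge 1$ be an integer. For real numbers $a_1,\dots,a_N$ put $$\rho(a_1,\dots,a_N)=\inf\Big\{\sum_{j=1}^N a_j\cos jt \;:\; t\in[0,\pi],\ \sum_{j=1}^N a_j\sin jt=0\Big\}.$$ Then $$\sup_{a_1+\cdots+a_N=1}\rho(a_1,\dots,a_N)=\frac{-1}{\cot^2\frac{\pi}{2(N+1)}}=-\tan^2\frac{\pi}{2(N+1)},$$ the supremum being over all real $a_1,\dots,a_N$ with sum $1$. Moreover, define $$a_j^0=2\tan\frac{\pi}{2(N+1)}\Big(1-\frac{j}{N+1}\Big)\sin\frac{\pi j}{N+1},\qquad j=1,\dots,N,$$ and, for $\epsilon>0$, $a_1^\epsilon=\dfrac{a_1^0+\epsilon}{1+\epsilon}$ and $a_j^\epsilon=\dfrac{a_j^0}{1+\epsilon}$ for $j=2,\dots,N$. Then $a_1^\epsilon+\cdots+a_N^\epsilon=1$ for every $\epsilon>0$, and $$\lim_{\epsilon\to0^+}\rho(a_1^\epsilon,\dots,a_N^\epsilon)=\frac{-1}{\cot^2\frac{\pi}{2(N+1)}}.$$ -/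

import Mathlib

/-- The cosine polynomial `∑_{j=1}^N a_j cos (j t)`; only the values `a 1, …, a N` matter. -/
noncomputable def cosPoly (N : ℕ) (a : ℕ → ℝ) (t : ℝ) : ℝ :=
  ∑ j ∈ Finset.Icc 1 N, a j * Real.cos (j * t)

/-- The conjugate sine polynomial `∑_{j=1}^N a_j sin (j t)`. -/
noncomputable def sinPoly (N : ℕ) (a : ℕ → ℝ) (t : ℝ) : ℝ :=
  ∑ j ∈ Finset.Icc 1 N, a j * Real.sin (j * t)

/-- The values of the cosine polynomial at the zeros in `[0, π]` of the sine polynomial. -/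
def realValues (N : ℕ) (a : ℕ → ℝ) : Set ℝ :=
  {x | ∃ t ∈ Set.Icc (0 : ℝ) Real.pi, sinPoly N a t = 0 ∧ x = cosPoly N a t}

/-- The infimum of `realValues`; the two lemmas below show that it is a genuine infimum. -/
noncomputable def rho (N : ℕ) (a : ℕ → ℝ) : ℝ :=
  sInf (realValues N a)

theorem realValues_nonempty (N : ℕ) (a : ℕ → ℝ) : (realValues N a).Nonempty :=
  ⟨cosPoly N a 0, 0, ⟨le_rfl, Real.pi_pos.le⟩, by simp [sinPoly], rfl⟩

theorem realValues_bddBelow (N : ℕ) (a : ℕ → ℝ) : BddBelow (realValues N a) := by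
  refine ⟨-∑ j ∈ Finset.Icc 1 N, |a j|, ?_⟩
  rintro x ⟨t, -, -, rfl⟩
  refine (abs_le.mp ((Finset.abs_sum_le_sum_abs _ _).trans (Finset.sum_le_sum ?_))).1
  intro j _
  rw [abs_mul]
  exact mul_le_of_le_one_right (abs_nonneg _) (Real.abs_cos_le_one _)

/-- The coefficients `a_j^0 = 2 tan(π/(2(N+1))) (1 - j/(N+1)) sin(πj/(N+1))`. -/
noncomputable def fejerCoeff (N : ℕ) (j : ℕ) : ℝ :=
  2 * Real.tan (Real.pi / (2 * ((N : ℝ) + 1))) * (1 - (j : ℝ) / ((N : ℝ) + 1)) *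
    Real.sin (Real.pi * (j : ℝ) / ((N : ℝ) + 1))

/-- The perturbed coefficients: `a_1^ε = (a_1^0 + ε)/(1 + ε)` and `a_j^ε = a_j^0/(1 + ε)`
for `j ≥ 2`. -/
noncomputable def perturbedCoeff (N : ℕ) (ε : ℝ) (j : ℕ) : ℝ :=
  if j = 1 then (fejerCoeff N 1 + ε) / (1 + ε) else fejerCoeff N j / (1 + ε)

/-! Upper bound. With y = cos t, the sine polynomial is sin t · U(y), the cosine polynomial is C(y),
and the admissible points are the zeros z of (y² - 1)U(y) in [-1, 1]. Let L be the mean over the N +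
1 nodes cos((2k+1)π/(N+1)). It kills T_m for 1 ≤ m ≤ N, whence L((y² - 1)U/(y - z)) = C(z) at every
such z (`nodeMean_eq_eval_cosPolynomial`). At z = 1 this value is ∑ a_j = 1. Every node is at most c
= cos(π/(N+1)). Write (y + 1)U as u times simple factors with roots in [-1, c), where u has constant
sign on [-1, c]. A sign argument (`exists_sum_prod_erase_nonpos`) then finds a root z with C(z) ≤
-(1 - c)/(1 + c) = -tan²(π/(2(N+1))); see `exists_nodeMean_le`.

Sharpness. For the coefficients a_j^0 the sine polynomial is a multiple of a difference of two
translates of a Fejér kernel, hence nonnegative on [0, π]. Its interior zeros could spoil the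
infimum; adding ε sin t removes them. Only t = 0 and t = π remain, and the value at π tends to the
bound as ε → 0. -/

open Polynomial

/-! ### Quadrature at the Chebyshev nodes -/

/-- The angle of the `k`-th quadrature node. -/
noncomputable def nodeAngle (N k : ℕ) : ℝ :=
  (2 * (k : ℝ) + 1) * (Real.pi / ((N : ℝ) + 1))

/-- The mean of a polynomial over the Chebyshev nodes `cos ((2k+1)π/(N+1))`, `0 ≤ k ≤ N`,
taken with repetition. -/
noncomputable def nodeMean (N : ℕ) : ℝ[X] →ₗ[ℝ] ℝ :=
  ((N : ℝ) + 1)⁻¹ • ∑ k ∈ Finset.range (N + 1), Polynomial.leval (Real.cos (nodeAngle N k))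

theorem nodeMean_apply (N : ℕ) (p : ℝ[X]) :
    nodeMean N p =
      ((N : ℝ) + 1)⁻¹ * ∑ k ∈ Finset.range (N + 1), p.eval (Real.cos (nodeAngle N k)) := by
  simp [nodeMean, Polynomial.leval]

theorem nodeMean_nonpos {N : ℕ} {p : ℝ[X]}
    (h : ∀ k ≤ N, p.eval (Real.cos (nodeAngle N k)) ≤ 0) : nodeMean N p ≤ 0 := by
  rw [nodeMean_apply]
  exact mul_nonpos_of_nonneg_of_nonpos (by positivity) 
    (Finset.sum_nonpos fun k hk => h k (by simpa [Nat.lt_succ_iff] using hk))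

theorem nodeMean_one (N : ℕ) : nodeMean N 1 = 1 := by
  rw [nodeMean_apply]
  simp
  field_simp

/-- With x = mπ/(N+1), multiplication by 2 sin x makes the sum telescope to sin(2mπ) = 0; the bounds
on m keep x in (0, π), so that sin x ≠ 0. -/
theorem sum_cos_nodeAngle_eq_zero {N m : ℕ} (hm : 1 ≤ m) (hmN : m ≤ N) :
    ∑ k ∈ Finset.range (N + 1), Real.cos (m * nodeAngle N k) = 0 := by
  have hM : (0 : ℝ) < (N : ℝ) + 1 := by positivity
  set x : ℝ := m * (Real.pi / ((N : ℝ) + 1)) with hx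
  have hx0 : 0 < Real.sin x := by
    apply Real.sin_pos_of_pos_of_lt_pi
    · have : (1 : ℝ) ≤ m := by exact_mod_cast hm
      have := Real.pi_pos
      positivity
    · have : (m : ℝ) ≤ N := by exact_mod_cast hmN
      rw [hx, mul_div_assoc', div_lt_iff₀ hM]
      nlinarith [Real.pi_pos]
  have htel : ∀ k : ℕ, 2 * Real.sin x * Real.cos (m * nodeAngle N k)
      = Real.sin (2 * ((k + 1 : ℕ) : ℝ) * x) - Real.sin (2 * (k : ℝ) * x) := by
    intro k
    rw [Real.sin_sub_sin]
    congr 2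
    · congr 1; push_cast; ring
    · rw [nodeAngle, hx]; push_cast; ring
  have h : 2 * Real.sin x * ∑ k ∈ Finset.range (N + 1), Real.cos (m * nodeAngle N k) = 0 := by
    rw [Finset.mul_sum, Finset.sum_congr rfl fun k _ => htel k,
      Finset.sum_range_sub (fun k : ℕ => Real.sin (2 * (k : ℝ) * x))]
    have : 2 * ((N + 1 : ℕ) : ℝ) * x = (2 * m : ℕ) * Real.pi := by
      rw [hx]; push_cast; field_simp
    rw [this, Real.sin_nat_mul_pi]
    simp
  exact (mul_eq_zero.mp h).resolve_left (by positivity)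

theorem eval_sq_sub_one_mul_chebyshevU (n : ℕ) (t : ℝ) :
    (((X : ℝ[X]) ^ 2 - 1) * Chebyshev.U ℝ n).eval (Real.cos t)
      = (Real.cos ((n + 2) * t) - Real.cos (n * t)) / 2 := by
  have h := Chebyshev.U_real_cos t (n : ℤ)
  have h2 : (((X : ℝ[X]) ^ 2 - 1) * Chebyshev.U ℝ n).eval (Real.cos t)
      = -(Real.sin t * Real.sin ((n + 1) * t)) := by
    push_cast at h
    rw [← h, eval_mul]
    simp only [eval_sub, eval_pow, eval_X, eval_one]
    linear_combination (Chebyshev.U ℝ n).eval (Real.cos t) * Real.sin_sq_add_cos_sq t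
  have e1 : ((n : ℝ) + 2) * t = (n + 1) * t + t := by ring
  have e2 : (n : ℝ) * t = (n + 1) * t - t := by ring
  rw [h2, e1, e2, Real.cos_add, Real.cos_sub]
  ring

theorem nodeMean_sq_sub_one_mul_chebyshevU {N n : ℕ} (hn : n + 2 ≤ N) :
    nodeMean N (((X : ℝ[X]) ^ 2 - 1) * Chebyshev.U ℝ n) = if n = 0 then -1 / 2 else 0 := by
  rw [nodeMean_apply]
  simp only [eval_sq_sub_one_mul_chebyshevU]
  rw [← Finset.sum_div, Finset.sum_sub_distrib]
  have h := sum_cos_nodeAngle_eq_zero (N := N) (m := n + 2) (by omega) hn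
  push_cast at h
  rw [h]
  split_ifs with h0
  · subst h0
    simp
    field_simp
    ring
  · rw [sum_cos_nodeAngle_eq_zero (by omega) (by omega)]
    simp

theorem nodeMean_X {N : ℕ} (hN : 1 ≤ N) : nodeMean N X = 0 := by
  have h := sum_cos_nodeAngle_eq_zero (N := N) le_rfl hN
  simp only [Nat.cast_one, one_mul] at h
  rw [nodeMean_apply]
  simp [h]

/-! ### Difference quotients and values of the cosine polynomial -/

/-- The difference quotient at `z` of the Chebyshev polynomial of the second kind, and its
mean against `y ^ 2 - 1`. -/
theorem exists_chebyshevU_sub_eq {N : ℕ} (z : ℝ) : ∀ n : ℕ, n + 1 ≤ N →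
    ∃ Q : ℝ[X], Chebyshev.U ℝ n - C ((Chebyshev.U ℝ n).eval z) = (X - C z) * Q ∧
      nodeMean N ((X ^ 2 - 1) * Q)
        = (Chebyshev.T ℝ (n + 1)).eval z - z * (Chebyshev.U ℝ n).eval z
  | 0, _ => ⟨0, by simp, by simp⟩
  | 1, h => by
    refine ⟨2, ?_, ?_⟩
    · simp [C_ofNat]
      ring
    · have h0 := nodeMean_sq_sub_one_mul_chebyshevU (N := N) (n := 0) (by omega)
      have e : ((X : ℝ[X]) ^ 2 - 1) * 2 = (2 : ℝ) • ((X ^ 2 - 1) * Chebyshev.U ℝ (0 : ℕ)) := by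
        rw [smul_eq_C_mul]; simp [C_ofNat]; ring
      rw [e, map_smul, h0]
      have hT := Chebyshev.T_add_two ℝ 0
      norm_num at hT ⊢
      rw [hT]
      simp
      ring
  | n + 2, h => by
    obtain ⟨Q₀, h₀, e₀⟩ := exists_chebyshevU_sub_eq (N := N) z n (by omega)
    obtain ⟨Q₁, h₁, e₁⟩ := exists_chebyshevU_sub_eq (N := N) z (n + 1) (by omega)
    have hU := Chebyshev.U_add_two ℝ n
    have hT := Chebyshev.T_add_two ℝ (n + 1)
    have hm := nodeMean_sq_sub_one_mul_chebyshevU (N := N) (n := n + 1) (by omega)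
    push_cast at h₀ e₀ h₁ e₁ hU hT hm ⊢
    rw [show (n : ℤ) + 1 + 2 = n + 2 + 1 by ring] at hT
    -- The recurrence for U, together with 2yU(y) - 2zU(z) = 2z(U(y) - U(z)) + 2(y - z)U(y) for U =
    -- U_{n+1}. The last term has mean zero against y² - 1.
    refine ⟨(2 * z) • Q₁ - Q₀ + (2 : ℝ) • Chebyshev.U ℝ (n + 1), ?_, ?_⟩
    · rw [hU]
      simp only [eval_sub, eval_mul, eval_X, eval_ofNat, smul_eq_C_mul, map_sub, map_mul,
        C_ofNat]
      linear_combination 2 * C z * h₁ - h₀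
    · have e : ((X : ℝ[X]) ^ 2 - 1) * ((2 * z) • Q₁ - Q₀ + (2 : ℝ) • Chebyshev.U ℝ (n + 1))
          = (2 * z) • ((X ^ 2 - 1) * Q₁) - (X ^ 2 - 1) * Q₀
            + (2 : ℝ) • ((X ^ 2 - 1) * Chebyshev.U ℝ (n + 1)) := by
        simp only [smul_eq_C_mul]; ring
      rw [e, map_add, map_sub, map_smul, map_smul, hm, e₀, e₁, hU, hT]
      rw [show (n : ℤ) + 1 + 1 = n + 2 by ring]
      simp only [eval_sub, eval_mul, eval_X, eval_ofNat, smul_eq_mul]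
      ring

/-- The polynomial `p` with `p (cos t) * sin t = sinPoly N a t`. -/
noncomputable def sinQuotient (N : ℕ) (a : ℕ → ℝ) : ℝ[X] :=
  ∑ j ∈ Finset.Icc 1 N, a j • Chebyshev.U ℝ ((j - 1 : ℕ) : ℤ)

/-- The polynomial `p` with `p (cos t) = cosPoly N a t`. -/
noncomputable def cosPolynomial (N : ℕ) (a : ℕ → ℝ) : ℝ[X] :=
  ∑ j ∈ Finset.Icc 1 N, a j • Chebyshev.T ℝ (j : ℤ)

theorem eval_sinQuotient_mul_sin (N : ℕ) (a : ℕ → ℝ) (t : ℝ) :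
    (sinQuotient N a).eval (Real.cos t) * Real.sin t = sinPoly N a t := by
  rw [sinQuotient, sinPoly, eval_finsetSum, Finset.sum_mul]
  refine Finset.sum_congr rfl fun j hj => ?_
  have h1 : 1 ≤ j := (Finset.mem_Icc.mp hj).1
  rw [eval_smul, smul_eq_mul, mul_assoc, Chebyshev.U_real_cos]
  push_cast [h1]
  congr 3
  ring

theorem eval_cosPolynomial (N : ℕ) (a : ℕ → ℝ) (t : ℝ) :
    (cosPolynomial N a).eval (Real.cos t) = cosPoly N a t := by
  rw [cosPolynomial, cosPoly, eval_finsetSum]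
  refine Finset.sum_congr rfl fun j _ => ?_
  rw [eval_smul, smul_eq_mul, Chebyshev.T_real_cos]
  simp

theorem exists_sinQuotient_sub_eq (N : ℕ) (a : ℕ → ℝ) (z : ℝ) :
    ∃ Q : ℝ[X], sinQuotient N a - C ((sinQuotient N a).eval z) = (X - C z) * Q ∧
      nodeMean N ((X ^ 2 - 1) * Q)
        = (cosPolynomial N a).eval z - z * (sinQuotient N a).eval z := by
  have h : ∀ j : ℕ, ∃ Q : ℝ[X], j ∈ Finset.Icc 1 N →
      Chebyshev.U ℝ ((j - 1 : ℕ) : ℤ) - C ((Chebyshev.U ℝ ((j - 1 : ℕ) : ℤ)).eval z)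
        = (X - C z) * Q ∧
      nodeMean N ((X ^ 2 - 1) * Q) = (Chebyshev.T ℝ (j : ℤ)).eval z
        - z * (Chebyshev.U ℝ ((j - 1 : ℕ) : ℤ)).eval z := by
    intro j
    by_cases hj : j ∈ Finset.Icc 1 N
    · obtain ⟨h1, h2⟩ := Finset.mem_Icc.mp hj
      obtain ⟨Q, hQ, hQ'⟩ := exists_chebyshevU_sub_eq (N := N) z (j - 1) (by omega)
      refine ⟨Q, fun _ => ⟨hQ, ?_⟩⟩
      rw [hQ']
      congr 3
      omega
    · exact ⟨0, fun h => absurd h hj⟩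
  choose Q hQ using h
  refine ⟨∑ j ∈ Finset.Icc 1 N, a j • Q j, ?_, ?_⟩
  · rw [sinQuotient, eval_finsetSum, map_sum, ← Finset.sum_sub_distrib, Finset.mul_sum]
    refine Finset.sum_congr rfl fun j hj => ?_
    rw [mul_smul_comm, ← (hQ j hj).1, smul_sub, eval_smul, smul_eq_mul, C_mul, smul_eq_C_mul,
      smul_eq_C_mul]
  · rw [sinQuotient, cosPolynomial, eval_finsetSum, eval_finsetSum, Finset.mul_sum,
      Finset.mul_sum, map_sum, ← Finset.sum_sub_distrib]
    refine Finset.sum_congr rfl fun j hj => ?_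
    rw [mul_smul_comm, map_smul, (hQ j hj).2, eval_smul, eval_smul]
    simp only [smul_eq_mul]
    ring

/-- The mean of `(y ^ 2 - 1) U(y) / (y - z)` at a zero `z` of the numerator is the value at `z`
of the conjugate cosine polynomial. -/
theorem nodeMean_eq_eval_cosPolynomial {N : ℕ} (hN : 1 ≤ N) (a : ℕ → ℝ) {z : ℝ} {q : ℝ[X]}
    (h : (X ^ 2 - 1) * sinQuotient N a = (X - C z) * q) :
    nodeMean N q = (cosPolynomial N a).eval z := by
  obtain ⟨Q, hQ, hQ'⟩ := exists_sinQuotient_sub_eq N a z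
  set s := (sinQuotient N a).eval z with hs
  have hz : (z ^ 2 - 1) * s = 0 := by
    have := congrArg (eval z) h
    simpa [← hs] using this
  have hzC : (C z ^ 2 - 1) * C s = 0 := by
    rw [← C_pow, ← C_1, ← C_sub, ← C_mul, hz, C_0]
  -- Since (z² - 1)s = 0, (y² - 1)s = s(y² - z²) is divisible by y - z. The term s(y + z) has mean
  -- sz, which cancels the -zs in `hQ'`.
  have hq : q = (X ^ 2 - 1) * Q + s • (X + C z) := by
    apply mul_left_cancel₀ (X_sub_C_ne_zero z)
    rw [← h, smul_eq_C_mul]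
    linear_combination (X ^ 2 - 1) * hQ + hzC
  rw [hq, map_add, hQ', map_smul, map_add, nodeMean_X hN,
    show C z = z • (1 : ℝ[X]) by rw [smul_eq_C_mul, mul_one], map_smul, nodeMean_one]
  simp only [smul_eq_mul]
  ring

/-! ### Sign arguments for products of linear factors -/

/-- If the weights `v` are nonpositive and the points `y` lie to the right of `-1`, then for a
decreasing list `l` ending in `-1` some product over `l` with one factor left out has
nonpositive weighted sum. -/
theorem exists_sum_prod_erase_nonpos {ι : Type*} (s : Finset ι) (y : ι → ℝ)
    (hy : ∀ k ∈ s, -1 ≤ y k) :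
    ∀ (l : List ℝ), l.Pairwise (· > ·) → (-1 : ℝ) ∈ l → (∀ z ∈ l, -1 ≤ z) →
      ∀ v : ι → ℝ, (∀ k ∈ s, v k ≤ 0) →
      ∃ z ∈ l, ∑ k ∈ s, ((l.erase z).map (fun w => y k - w)).prod * v k ≤ 0
  | [], _, h, _, _, _ => by simp at h
  | [z₁], _, _, _, v, hv => ⟨z₁, by simp, by simpa using Finset.sum_nonpos hv⟩
  | [z₁, z₂], hp, hm, hge, v, hv => by
    have hp' : z₂ < z₁ := by simpa using hp
    have h₂ : z₂ = -1 := by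
      have := hge z₂ (by simp)
      rcases List.mem_cons.mp hm with h | h
      · linarith
      · exact (List.mem_singleton.mp h).symm
    refine ⟨z₁, by simp, ?_⟩
    simp only [List.erase_cons_head, List.map_cons, List.map_nil, List.prod_cons, List.prod_nil,
      mul_one]
    refine Finset.sum_nonpos fun k hk => mul_nonpos_of_nonneg_of_nonpos ?_ (hv k hk)
    have := hy k hk
    linarith
  | z₁ :: z₂ :: z₃ :: l, hp, hm, hge, v, hv => by
    set r := z₃ :: l with hr
    rw [List.pairwise_cons, List.pairwise_cons] at hp
    obtain ⟨hp₁, hp₂, hp₃⟩ := hp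
    have h₁₂ : z₂ < z₁ := hp₁ z₂ (by simp)
    have hmr : (-1 : ℝ) ∈ r := by
      have h₃ := hge z₃ (by simp [hr])
      have h₂₃ := hp₂ z₃ (by simp [hr])
      rcases List.mem_cons.mp hm with h | h
      · linarith
      rcases List.mem_cons.mp h with h | h
      · linarith
      · exact h
    -- Two points are dropped at a time, so that the new weights carry a square and stay
    -- nonpositive.
    obtain ⟨z, hz, hsum⟩ := exists_sum_prod_erase_nonpos s y hy r hp₃ hmr
      (fun w hw => hge w (by simp [hw])) (fun k => (y k - z₂) ^ 2 * v k)
      (fun k hk => mul_nonpos_of_nonneg_of_nonpos (sq_nonneg _) (hv k hk))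
    have hz₂ : z < z₂ := hp₂ z hz
    have herase : (z₁ :: z₂ :: r).erase z = z₁ :: z₂ :: r.erase z := by
      rw [List.erase_cons_tail (by simpa using (hz₂.trans h₁₂).ne'),
        List.erase_cons_tail (by simpa using hz₂.ne')]
    by_cases hcase : ∑ k ∈ s, (((z₁ :: z₂ :: r).erase z).map (fun w => y k - w)).prod * v k ≤ 0
    · exact ⟨z, by simp [hz], hcase⟩
    refine ⟨z₁, by simp, ?_⟩
    -- From (z₁ - z)(y - z₂) = (z₁ - z₂)(y - z) + (z₂ - z)(y - z₁). All three constants are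
    -- positive, so omitting `z₁` or omitting `z` gives a nonpositive sum.
    have hid : (z₁ - z) * ∑ k ∈ s, ((r.erase z).map (fun w => y k - w)).prod *
          ((y k - z₂) ^ 2 * v k)
        = (z₁ - z₂) * ∑ k ∈ s, (((z₁ :: z₂ :: r).erase z₁).map (fun w => y k - w)).prod * v k
          + (z₂ - z) *
            ∑ k ∈ s, (((z₁ :: z₂ :: r).erase z).map (fun w => y k - w)).prod * v k := by
      rw [Finset.mul_sum, Finset.mul_sum, Finset.mul_sum, ← Finset.sum_add_distrib]
      refine Finset.sum_congr rfl fun k _ => ?_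
      rw [herase, List.erase_cons_head]
      simp only [List.map_cons, List.prod_cons]
      rw [← List.prod_map_erase (fun w => y k - w) hz]
      ring
    push Not at hcase
    have h1 := mul_nonpos_of_nonneg_of_nonpos (by linarith : 0 ≤ z₁ - z) hsum
    have h2 := mul_pos (by linarith : 0 < z₂ - z) hcase
    by_contra hcon
    push Not at hcon
    have h3 := mul_pos (by linarith : 0 < z₁ - z₂) hcon
    linarith

/-- A real polynomial is the product of simple factors with distinct roots in an open interval
and of a polynomial of constant sign on the interval. -/
theorem exists_prod_mul_constant_sign {a b : ℝ} (p : ℝ[X]) :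
    ∃ (Z : Finset ℝ) (u : ℝ[X]), (∀ x ∈ Z, x ∈ Set.Ioo a b) ∧ p = (∏ x ∈ Z, (X - C x)) * u ∧
      ((∀ y ∈ Set.Icc a b, 0 ≤ u.eval y) ∨ (∀ y ∈ Set.Icc a b, u.eval y ≤ 0)) := by
  induction hn : p.natDegree using Nat.strong_induction_on generalizing p with
  | _ n ih =>
    by_cases hsign : (∀ y ∈ Set.Icc a b, 0 ≤ p.eval y) ∨ (∀ y ∈ Set.Icc a b, p.eval y ≤ 0)
    · exact ⟨∅, p, by simp, by simp, hsign⟩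
    push Not at hsign
    obtain ⟨⟨y₁, hy₁, h₁⟩, ⟨y₂, hy₂, h₂⟩⟩ := hsign
    have hroot : ∃ r ∈ Set.Ioo a b, p.eval r = 0 := by
      have hcont : ContinuousOn (fun y => p.eval y) (Set.uIcc y₁ y₂) :=
        p.continuous.continuousOn
      have hmem : (0 : ℝ) ∈ Set.uIcc (p.eval y₁) (p.eval y₂) := by
        rw [Set.uIcc_of_le (by linarith)]
        exact ⟨h₁.le, h₂.le⟩
      obtain ⟨r, hr, hr0⟩ := intermediate_value_uIcc hcont hmem
      have hr0 : p.eval r = 0 := hr0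
      have hne₁ : r ≠ y₁ := by rintro rfl; linarith
      have hne₂ : r ≠ y₂ := by rintro rfl; linarith
      refine ⟨r, ?_, hr0⟩
      obtain ⟨hl, hu⟩ := hr
      rcases le_total y₁ y₂ with h | h
      · rw [min_eq_left h] at hl
        rw [max_eq_right h] at hu
        exact ⟨hy₁.1.trans_lt (lt_of_le_of_ne hl hne₁.symm),
          (lt_of_le_of_ne hu hne₂).trans_le hy₂.2⟩
      · rw [min_eq_right h] at hl
        rw [max_eq_left h] at hu
        exact ⟨hy₂.1.trans_lt (lt_of_le_of_ne hl hne₂.symm),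
          (lt_of_le_of_ne hu hne₁).trans_le hy₁.2⟩
    obtain ⟨r, hr, hr0⟩ := hroot
    obtain ⟨q, hq⟩ := dvd_iff_isRoot.mpr hr0
    have hq0 : q ≠ 0 := by
      rintro rfl
      rw [hq] at h₁
      simp at h₁
    have hdeg : q.natDegree < n := by
      rw [← hn, hq, natDegree_mul (X_sub_C_ne_zero r) hq0, natDegree_X_sub_C]
      omega
    obtain ⟨Z, u, hZ, hprod, hu⟩ := ih q.natDegree hdeg q rfl
    by_cases hrZ : r ∈ Z
    -- A repeated root does not change the sign: both copies go into `u` as a square.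
    · refine ⟨Z.erase r, (X - C r) ^ 2 * u, fun x hx => hZ x (Finset.mem_of_mem_erase hx), ?_, ?_⟩
      · rw [hq, hprod, ← Finset.mul_prod_erase Z _ hrZ]
        ring
      · simp only [eval_mul, eval_pow, eval_sub, eval_X, eval_C]
        exact hu.imp (fun h y hy => mul_nonneg (sq_nonneg _) (h y hy))
          (fun h y hy => mul_nonpos_of_nonneg_of_nonpos (sq_nonneg _) (h y hy))
    · refine ⟨insert r Z, u, ?_, ?_, hu⟩
      · intro x hx
        rcases Finset.mem_insert.mp hx with rfl | hx
        · exact hr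
        · exact hZ x hx
      · rw [Finset.prod_insert hrZ, hq, hprod]
        ring

/-- If `u` has the sign of `c - y` at the nodes `y`, and the product of `u` with the
factors `y - w`, `w ∈ l`, has mean `1`, then replacing a suitable factor by `y - 1` makes the
mean at most `-(1 - c) / (1 + c)`. -/
theorem exists_nodeMean_le {N : ℕ} {c : ℝ} (hc : c < 1) {l : List ℝ} (hl : l.Pairwise (· > ·))
    (hm : (-1 : ℝ) ∈ l) (hge : ∀ z ∈ l, -1 ≤ z) (hlt : ∀ z ∈ l, z < c) {u : ℝ[X]}
    (hu : ∀ k ≤ N, (Real.cos (nodeAngle N k) - c) * u.eval (Real.cos (nodeAngle N k)) ≤ 0)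
    (hone : nodeMean N ((l.map (fun w => X - C w)).prod * u) = 1) :
    ∃ z ∈ l, (1 + c) * nodeMean N ((X - 1) * (((l.erase z).map (fun w => X - C w)).prod * u))
      ≤ -(1 - c) := by
  obtain ⟨z, hz, hsum⟩ := exists_sum_prod_erase_nonpos (Finset.range (N + 1))
    (fun k => Real.cos (nodeAngle N k)) (fun k _ => Real.neg_one_le_cos _) l hl hm hge
    (fun k => (Real.cos (nodeAngle N k) - c) * u.eval (Real.cos (nodeAngle N k)))
    (fun k hk => hu k (by simpa [Nat.lt_succ_iff] using hk))
  refine ⟨z, hz, ?_⟩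
  have heval : ∀ (l' : List ℝ) (x : ℝ),
      ((l'.map (fun w => X - C w)).prod).eval x = (l'.map (fun w => x - w)).prod := by
    intro l' x
    rw [eval_list_prod, List.map_map]
    congr 2
    funext w
    simp
  set q := ((l.erase z).map (fun w => X - C w)).prod * u with hq
  have hmean : nodeMean N ((X - C c) * q) ≤ 0 := by
    rw [nodeMean_apply]
    refine mul_nonpos_of_nonneg_of_nonpos (by positivity) (le_of_eq_of_le ?_ hsum)
    refine Finset.sum_congr rfl fun k _ => ?_
    rw [hq, eval_mul, eval_mul, heval]
    simp only [eval_sub, eval_X, eval_C]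
    ring
  -- From (1 - z)(y - c) = (1 - c)(y - z) + (c - z)(y - 1).
  have hid : (1 - z) • ((X - C c) * q)
      = (1 - c) • ((l.map (fun w => X - C w)).prod * u) + (c - z) • ((X - 1) * q) := by
    rw [← List.prod_map_erase (fun w => X - C w) hz, hq]
    simp only [smul_eq_C_mul, map_sub, C_1]
    ring
  have h := congrArg (nodeMean N) hid
  rw [map_add, map_smul, map_smul, map_smul, hone] at h
  simp only [smul_eq_mul] at h
  have hzc := hlt z hz
  have hz1 := hge z hz
  have h1 := mul_nonpos_of_nonneg_of_nonpos (by linarith : 0 ≤ 1 - z) hmean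
  set g := nodeMean N ((X - 1) * q)
  have h2 : (c - z) * g ≤ -(1 - c) := by linarith
  -- Multiply `h2` by 1 + c and use 0 < c - z ≤ 1 + c, which holds because -1 ≤ z < c.
  have h3 : (c - z) * ((1 + c) * g) ≤ (c - z) * (-(1 - c)) := by nlinarith
  exact le_of_mul_le_mul_left h3 (by linarith)

/-! ### The upper bound -/

theorem cos_nodeAngle_le {N k : ℕ} (hk : k ≤ N) :
    Real.cos (nodeAngle N k) ≤ Real.cos (Real.pi / ((N : ℝ) + 1)) := by
  have hM : (0 : ℝ) < (N : ℝ) + 1 := by positivity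
  set θ := Real.pi / ((N : ℝ) + 1) with hθ
  have hπ : Real.pi = ((N : ℝ) + 1) * θ := by rw [hθ]; field_simp
  have hθ0 : 0 < θ := div_pos Real.pi_pos hM
  have hk' : (k : ℝ) ≤ N := by exact_mod_cast hk
  have hk0 : (0 : ℝ) ≤ k := k.cast_nonneg
  have hlo : θ ≤ nodeAngle N k := by rw [nodeAngle]; nlinarith
  have hhi : nodeAngle N k ≤ 2 * Real.pi - θ := by
    rw [nodeAngle, ← hθ]
    nlinarith
  rcases le_total (nodeAngle N k) Real.pi with h | h
  · exact Real.cos_le_cos_of_nonneg_of_le_pi hθ0.le h hlo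
  · rw [← Real.cos_two_pi_sub]
    exact Real.cos_le_cos_of_nonneg_of_le_pi hθ0.le (by linarith) (by linarith)

theorem prod_sort_map (s : Finset ℝ) (f : ℝ → ℝ[X]) :
    ((s.sort (· ≥ ·)).map f).prod = ∏ x ∈ s, f x := by
  rw [← List.prod_toFinset f (s.sort_nodup _), Finset.sort_toFinset]

theorem pi_div_two_mul_mem_Ioo {N : ℕ} (hN : 1 ≤ N) :
    Real.pi / (2 * ((N : ℝ) + 1)) ∈ Set.Ioo 0 (Real.pi / 2) := by
  have h1 : (1 : ℝ) ≤ N := by exact_mod_cast hN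
  have hp := Real.pi_pos
  refine ⟨by positivity, ?_⟩
  rw [div_lt_div_iff₀ (by positivity) (by positivity)]
  nlinarith

theorem one_add_cos_mul_tan_sq {N : ℕ} (hN : 1 ≤ N) :
    (1 + Real.cos (Real.pi / ((N : ℝ) + 1))) * Real.tan (Real.pi / (2 * ((N : ℝ) + 1))) ^ 2
      = 1 - Real.cos (Real.pi / ((N : ℝ) + 1)) := by
  obtain ⟨h0, h1⟩ := pi_div_two_mul_mem_Ioo hN
  have hcos := Real.cos_pos_of_mem_Ioo ⟨by linarith, h1⟩
  have e : Real.pi / ((N : ℝ) + 1) = 2 * (Real.pi / (2 * ((N : ℝ) + 1))) := by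
    field_simp
  rw [e, Real.cos_two_mul, Real.tan_eq_sin_div_cos]
  set φ := Real.pi / (2 * ((N : ℝ) + 1))
  field_simp
  linear_combination 2 * Real.cos φ ^ 2 * Real.sin_sq_add_cos_sq φ

theorem rho_le_cosPoly {N : ℕ} {a : ℕ → ℝ} {t : ℝ} (ht : t ∈ Set.Icc 0 Real.pi)
    (h : sinPoly N a t = 0) : rho N a ≤ cosPoly N a t :=
  csInf_le (realValues_bddBelow N a) ⟨t, ht, h, rfl⟩

theorem rho_le_nodeMean {N : ℕ} (hN : 1 ≤ N) {a : ℕ → ℝ} {z : ℝ} (hz : z ∈ Set.Icc (-1) 1)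
    {q : ℝ[X]} (h : (X ^ 2 - 1) * sinQuotient N a = (X - C z) * q) :
    rho N a ≤ nodeMean N q := by
  have hcos : Real.cos (Real.arccos z) = z := Real.cos_arccos hz.1 hz.2
  rw [nodeMean_eq_eval_cosPolynomial hN a h, ← hcos, eval_cosPolynomial]
  refine rho_le_cosPoly ⟨Real.arccos_nonneg z, Real.arccos_le_pi z⟩ ?_
  rw [← eval_sinQuotient_mul_sin, hcos]
  have h0 : (z ^ 2 - 1) * (sinQuotient N a).eval z = 0 := by
    have := congrArg (eval z) h
    simpa using this
  rcases mul_eq_zero.mp h0 with h1 | h1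
  · have : Real.sin (Real.arccos z) ^ 2 = 0 := by
      rw [Real.sin_sq, hcos]
      linarith
    rw [pow_eq_zero_iff (by norm_num)] at this
    rw [this, mul_zero]
  · rw [h1, zero_mul]

theorem rho_le_neg_tan_sq {N : ℕ} (hN : 1 ≤ N) {a : ℕ → ℝ}
    (ha : ∑ j ∈ Finset.Icc 1 N, a j = 1) :
    rho N a ≤ -Real.tan (Real.pi / (2 * ((N : ℝ) + 1))) ^ 2 := by
  have hτ := one_add_cos_mul_tan_sq hN
  set τ := Real.tan (Real.pi / (2 * ((N : ℝ) + 1))) ^ 2 with hτdef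
  have hτ0 : 0 ≤ τ := sq_nonneg _
  set c := Real.cos (Real.pi / ((N : ℝ) + 1)) with hc
  have hc1 : c < 1 := by
    have hM : (1 : ℝ) ≤ (N : ℝ) + 1 := by linarith [(Nat.cast_nonneg N : (0 : ℝ) ≤ N)]
    rw [hc]
    conv_rhs => rw [← Real.cos_zero]
    exact Real.cos_lt_cos_of_nonneg_of_le_pi le_rfl (div_le_self Real.pi_pos.le hM)
      (by have := Real.pi_pos; positivity)
  have hcm : -1 ≤ c := Real.neg_one_le_cos _
  by_contra hcon
  push Not at hcon
  have key : ∀ z ∈ Set.Icc (-1 : ℝ) 1, ∀ q : ℝ[X],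
      (X ^ 2 - 1) * sinQuotient N a = (X - C z) * q → -τ < nodeMean N q :=
    fun z hz q hq => hcon.trans_le (rho_le_nodeMean hN hz hq)
  -- The interval ends at the largest node c, not at 1: only the signs at the nodes matter, and c
  -- gives the sharp constant.
  obtain ⟨Z, u, hZ, hfac, hsign⟩ :=
    exists_prod_mul_constant_sign (a := -1) (b := c) (sinQuotient N a)
  have hZm : (-1 : ℝ) ∉ Z := fun h => lt_irrefl _ (hZ _ h).1
  obtain ⟨L, hL⟩ : ∃ L, L = (insert (-1 : ℝ) Z).sort (· ≥ ·) := ⟨_, rfl⟩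
  have hLmem : ∀ x, x ∈ L ↔ x = -1 ∨ x ∈ Z := by
    intro x
    rw [hL, Finset.mem_sort, Finset.mem_insert]
  have hLp : L.Pairwise (· > ·) := by
    rw [hL]
    exact (Finset.sortedGT_sort _).pairwise
  have hLge : ∀ x ∈ L, -1 ≤ x := by
    intro x hx
    rcases (hLmem x).mp hx with rfl | h
    · exact le_rfl
    · exact (hZ x h).1.le
  have hLlt : ∀ x ∈ L, x < 1 := by
    intro x hx
    rcases (hLmem x).mp hx with rfl | h
    · norm_num
    · exact (hZ x h).2.trans hc1
  have hLm : (-1 : ℝ) ∈ L := (hLmem _).mpr (Or.inl rfl)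
  have hprod : (X ^ 2 - 1) * sinQuotient N a
      = (X - C 1) * ((L.map (fun w => X - C w)).prod * u) := by
    rw [hL, prod_sort_map, Finset.prod_insert hZm, hfac]
    simp only [C_neg, C_1]
    ring
  have hone : nodeMean N ((L.map (fun w => X - C w)).prod * u) = 1 := by
    rw [nodeMean_eq_eval_cosPolynomial hN a hprod, ← Real.cos_zero, eval_cosPolynomial,
      cosPoly]
    simpa using ha
  have hnode : ∀ k ≤ N, Real.cos (nodeAngle N k) ∈ Set.Icc (-1) c :=
    fun k hk => ⟨Real.neg_one_le_cos _, cos_nodeAngle_le hk⟩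
  rcases hsign with hu | hu
  · have hLc : ∀ x ∈ L, x < c := by
      intro x hx
      rcases (hLmem x).mp hx with rfl | h
      · rcases hcm.eq_or_lt with h | h
        · nlinarith
        · exact h
      · exact (hZ x h).2
    obtain ⟨z, hz, hle⟩ := exists_nodeMean_le hc1 hLp hLm hLge hLc
      (fun k hk => mul_nonpos_of_nonpos_of_nonneg (by linarith [(hnode k hk).2])
        (hu _ (hnode k hk))) hone
    have hg := key z ⟨hLge z hz, (hLlt z hz).le⟩
      ((X - 1) * (((L.erase z).map (fun w => X - C w)).prod * u)) (by
        rw [hprod, ← List.prod_map_erase (fun w => X - C w) hz, C_1]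
        ring)
    nlinarith [hLc z hz, hLge z hz]
  · match L, hL with
    | [], _ => simp at hLm
    | [m], _ =>
      have hm : m = -1 := (List.mem_singleton.mp hLm).symm
      have : nodeMean N (([m].map (fun w => X - C w)).prod * u) ≤ 0 := by
        refine nodeMean_nonpos fun k hk => ?_
        have h := (hnode k hk).1
        have := mul_nonpos_of_nonneg_of_nonpos
          (by linarith : 0 ≤ Real.cos (nodeAngle N k) - -1) (hu _ (hnode k hk))
        simpa [hm] using this
      linarith
    -- When u ≤ 0, the largest root m takes the role of c and its factor joins u: (y - m)·(y - m)u ≤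
    -- 0 at the nodes. As m < c, the bound -(1 - m)/(1 + m) is even stronger.
    | m :: b :: r, _ =>
      obtain ⟨hmp, hlp⟩ := List.pairwise_cons.mp hLp
      have hbm : b < m := hmp b (by simp)
      have hb1 : -1 ≤ b := hLge b (by simp)
      have hmZ : m ∈ Z := by
        rcases (hLmem m).mp (by simp) with h | h
        · linarith
        · exact h
      have hmc : m < c := (hZ m hmZ).2
      have hlm : (-1 : ℝ) ∈ b :: r := by
        rcases List.mem_cons.mp hLm with h | h
        · linarith
        · exact h
      have hone' : nodeMean N (((b :: r).map (fun w => X - C w)).prod * ((X - C m) * u)) = 1 := by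
        rw [← hone, List.map_cons (l := b :: r), List.prod_cons]
        congr 1
        ring
      obtain ⟨z, hz, hle⟩ := exists_nodeMean_le (hmc.trans hc1) hlp hlm
        (fun z hz => hLge z (List.mem_cons_of_mem _ hz)) hmp
        (fun k hk => by
          simp only [eval_mul, eval_sub, eval_X, eval_C]
          rw [← mul_assoc]
          exact mul_nonpos_of_nonneg_of_nonpos (mul_self_nonneg _) (hu _ (hnode k hk))) hone'
      have hzL : z ∈ m :: b :: r := List.mem_cons_of_mem _ hz
      have hg := key z ⟨hLge z hzL, (hLlt z hzL).le⟩
        ((X - 1) * ((((b :: r).erase z).map (fun w => X - C w)).prod * ((X - C m) * u))) (by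
          rw [hprod, List.map_cons, List.prod_cons,
            ← List.prod_map_erase (fun w => X - C w) hz, C_1]
          ring)
      nlinarith [mul_nonneg (sub_nonneg.mpr hmc.le) hτ0]

/-! ### Dirichlet and Fejér sums -/

theorem dirichlet_cos_sum (n : ℕ) (u : ℝ) :
    (1 - Real.cos u) * (1 + 2 * ∑ j ∈ Finset.Icc 1 n, Real.cos (j * u))
      = Real.cos (n * u) - Real.cos ((n + 1) * u) := by
  induction n with
  | zero => simp
  | succ n ih =>
    rw [Finset.sum_Icc_succ_top (by omega), mul_add 2, ← add_assoc, mul_add, ih]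
    push_cast
    have e1 : ((n : ℝ) + 1 + 1) * u = (n + 1) * u + u := by ring
    have e2 : (n : ℝ) * u = (n + 1) * u - u := by ring
    rw [e1, e2, Real.cos_add, Real.cos_sub]
    ring

theorem dirichlet_sin_sum (n : ℕ) (u : ℝ) :
    (1 - Real.cos u) * (2 * ∑ j ∈ Finset.Icc 1 n, Real.sin (j * u))
      = Real.sin u + Real.sin (n * u) - Real.sin ((n + 1) * u) := by
  induction n with
  | zero => simp
  | succ n ih =>
    rw [Finset.sum_Icc_succ_top (by omega), mul_add 2, mul_add, ih]
    push_cast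
    have e1 : ((n : ℝ) + 1 + 1) * u = (n + 1) * u + u := by ring
    have e2 : (n : ℝ) * u = (n + 1) * u - u := by ring
    rw [e1, e2, Real.sin_add, Real.sin_sub]
    ring

/-- Raising n adds one unweighted sum, so Fejér sums accumulate Dirichlet sums; this drives both
inductions below. -/
theorem sum_Icc_weight_succ (n : ℕ) (f : ℕ → ℝ) :
    ∑ j ∈ Finset.Icc 1 (n + 1), (((n + 1 : ℕ) : ℝ) + 1 - j) * f j
      = ∑ j ∈ Finset.Icc 1 n, ((n : ℝ) + 1 - j) * f j + ∑ j ∈ Finset.Icc 1 (n + 1), f j := by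
  rw [Finset.sum_Icc_succ_top (by omega), Finset.sum_Icc_succ_top (by omega), ← add_assoc,
    ← Finset.sum_add_distrib]
  congr 1
  · refine Finset.sum_congr rfl fun j _ => ?_
    push_cast
    ring
  · push_cast
    ring

theorem fejer_cos_sum (n : ℕ) (u : ℝ) :
    (1 - Real.cos u) * ((n + 1) + 2 * ∑ j ∈ Finset.Icc 1 n, ((n : ℝ) + 1 - j) * Real.cos (j * u))
      = 1 - Real.cos ((n + 1) * u) := by
  induction n with
  | zero => simp
  | succ n ih =>
    have h := dirichlet_cos_sum (n + 1) u
    rw [sum_Icc_weight_succ n fun j => Real.cos (j * u)]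
    push_cast at h ih ⊢
    linear_combination ih + h

theorem fejer_sin_sum (n : ℕ) (u : ℝ) :
    (1 - Real.cos u) * (2 * ∑ j ∈ Finset.Icc 1 n, ((n : ℝ) + 1 - j) * Real.sin (j * u))
      = (n + 1) * Real.sin u - Real.sin ((n + 1) * u) := by
  induction n with
  | zero => simp
  | succ n ih =>
    have h := dirichlet_sin_sum (n + 1) u
    rw [sum_Icc_weight_succ n fun j => Real.sin (j * u)]
    push_cast at h ih ⊢
    linear_combination ih + h

/-! ### The extremal coefficients -/

theorem fejerCoeff_eq (N j : ℕ) :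
    fejerCoeff N j = 2 * Real.tan (Real.pi / (2 * ((N : ℝ) + 1))) / ((N : ℝ) + 1) *
      (((N : ℝ) + 1 - j) * Real.sin (j * (Real.pi / ((N : ℝ) + 1)))) := by
  have hM : (N : ℝ) + 1 ≠ 0 := by positivity
  rw [fejerCoeff, show Real.pi * (j : ℝ) / ((N : ℝ) + 1) = j * (Real.pi / ((N : ℝ) + 1)) by ring]
  field_simp

theorem sum_fejerCoeff {N : ℕ} (hN : 1 ≤ N) : ∑ j ∈ Finset.Icc 1 N, fejerCoeff N j = 1 := by
  obtain ⟨h0, h1⟩ := pi_div_two_mul_mem_Ioo hN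
  have hM : (N : ℝ) + 1 ≠ 0 := by positivity
  have h := fejer_sin_sum N (Real.pi / ((N : ℝ) + 1))
  simp only [fejerCoeff_eq]
  rw [← Finset.mul_sum]
  rw [mul_div_cancel₀ _ hM, Real.sin_pi, sub_zero,
    show Real.pi / ((N : ℝ) + 1) = 2 * (Real.pi / (2 * ((N : ℝ) + 1))) by field_simp] at h
  rw [show Real.pi / ((N : ℝ) + 1) = 2 * (Real.pi / (2 * ((N : ℝ) + 1))) by field_simp]
  set φ := Real.pi / (2 * ((N : ℝ) + 1))
  have hs : 0 < Real.sin φ := Real.sin_pos_of_pos_of_lt_pi h0 (by linarith [Real.pi_pos])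
  have hc : 0 < Real.cos φ := Real.cos_pos_of_mem_Ioo ⟨by linarith, h1⟩
  set A := ∑ j ∈ Finset.Icc 1 N, ((N : ℝ) + 1 - j) * Real.sin (j * (2 * φ))
  rw [Real.sin_two_mul, Real.cos_two_mul', Real.cos_sq'] at h
  rw [Real.tan_eq_sin_div_cos]
  field_simp
  apply mul_left_cancel₀ hs.ne'
  linear_combination h / 2

theorem cosPoly_fejerCoeff_pi {N : ℕ} (hN : 1 ≤ N) :
    cosPoly N (fejerCoeff N) Real.pi = -Real.tan (Real.pi / (2 * ((N : ℝ) + 1))) ^ 2 := by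
  obtain ⟨h0, h1⟩ := pi_div_two_mul_mem_Ioo hN
  have hM : (N : ℝ) + 1 ≠ 0 := by positivity
  -- The shift by π absorbs the signs cos(jπ), since sin(jθ) cos(jπ) = sin(j(θ + π)).
  have h := fejer_sin_sum N (Real.pi / ((N : ℝ) + 1) + Real.pi)
  have hterm : ∀ j : ℕ, fejerCoeff N j * Real.cos (j * Real.pi)
      = 2 * Real.tan (Real.pi / (2 * ((N : ℝ) + 1))) / ((N : ℝ) + 1) *
        (((N : ℝ) + 1 - j) * Real.sin (j * (Real.pi / ((N : ℝ) + 1) + Real.pi))) := by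
    intro j
    rw [fejerCoeff_eq, mul_add (j : ℝ), Real.sin_add, Real.sin_nat_mul_pi]
    ring
  rw [cosPoly, Finset.sum_congr rfl fun j _ => hterm j, ← Finset.mul_sum]
  have hz : Real.sin (((N : ℝ) + 1) * (Real.pi / ((N : ℝ) + 1) + Real.pi)) = 0 := by
    rw [mul_add, mul_div_cancel₀ _ hM,
      show Real.pi + ((N : ℝ) + 1) * Real.pi = ((N + 2 : ℕ) : ℝ) * Real.pi by push_cast; ring]
    exact Real.sin_nat_mul_pi _
  rw [hz, Real.cos_add_pi, Real.sin_add_pi] at h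
  set A := ∑ j ∈ Finset.Icc 1 N,
    ((N : ℝ) + 1 - j) * Real.sin (j * (Real.pi / ((N : ℝ) + 1) + Real.pi))
  rw [show Real.pi / ((N : ℝ) + 1) = 2 * (Real.pi / (2 * ((N : ℝ) + 1))) by field_simp] at h
  set φ := Real.pi / (2 * ((N : ℝ) + 1))
  have hc : 0 < Real.cos φ := Real.cos_pos_of_mem_Ioo ⟨by linarith, h1⟩
  rw [Real.sin_two_mul, Real.cos_two_mul] at h
  rw [Real.tan_eq_sin_div_cos]
  field_simp
  apply mul_left_cancel₀ hc.ne'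
  linear_combination Real.sin φ * h / 2

/-- With M = N + 1 and θ = π/M, the product formula gives a positive multiple of F(t - θ) - F(t +
θ). Since Mθ = π, (1 - cos u)(M + 2F(u)) equals 1 + cos(Mt) at both u = t ± θ, and cos(t + θ) ≤
cos(t - θ) decides the comparison. -/
theorem sinPoly_fejerCoeff_nonneg {N : ℕ} (hN : 1 ≤ N) {t : ℝ} (ht : t ∈ Set.Icc 0 Real.pi) :
    0 ≤ sinPoly N (fejerCoeff N) t := by
  obtain ⟨h0, h1⟩ := pi_div_two_mul_mem_Ioo hN
  have hM : (0 : ℝ) < (N : ℝ) + 1 := by positivity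
  set θ := Real.pi / ((N : ℝ) + 1) with hθ
  set F : ℝ → ℝ := fun u => ∑ j ∈ Finset.Icc 1 N, ((N : ℝ) + 1 - j) * Real.cos (j * u) with hF
  have hrep : sinPoly N (fejerCoeff N) t
      = Real.tan (Real.pi / (2 * ((N : ℝ) + 1))) / ((N : ℝ) + 1) * (F (t - θ) - F (t + θ)) := by
    rw [sinPoly, hF]
    simp only
    rw [← Finset.sum_sub_distrib, Finset.mul_sum]
    refine Finset.sum_congr rfl fun j _ => ?_
    rw [fejerCoeff_eq, ← hθ, mul_sub (j : ℝ), mul_add (j : ℝ), Real.cos_sub, Real.cos_add]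
    ring
  have hle : F (t + θ) ≤ F (t - θ) := by
    have hp := fejer_cos_sum N (t - θ)
    have hq := fejer_cos_sum N (t + θ)
    have ep : ((N : ℝ) + 1) * (t - θ) = ((N : ℝ) + 1) * t - Real.pi := by
      rw [hθ]; field_simp
    have eq : ((N : ℝ) + 1) * (t + θ) = ((N : ℝ) + 1) * t + Real.pi := by
      rw [hθ]; field_simp
    rw [ep, Real.cos_sub_pi] at hp
    rw [eq, Real.cos_add_pi] at hq
    have hθπ : θ ≤ Real.pi := div_le_self Real.pi_pos.le (by
      linarith [(Nat.cast_nonneg N : (0 : ℝ) ≤ N)])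
    have hθ0 : 0 ≤ θ := by have := Real.pi_pos; positivity
    have hpq : Real.cos (t + θ) ≤ Real.cos (t - θ) := by
      have h3 := mul_nonneg (Real.sin_nonneg_of_mem_Icc ht)
        (Real.sin_nonneg_of_mem_Icc ⟨hθ0, hθπ⟩)
      rw [Real.cos_add, Real.cos_sub]
      linarith
    have hK := Real.neg_one_le_cos (((N : ℝ) + 1) * t)
    rcases (Real.cos_le_one (t - θ)).eq_or_lt with h | h
    -- Here 1 - cos(t - θ) = 0 and the Fejér identity says nothing, but every cosine in F(t - θ) is
    -- 1, so F is maximal there.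
    · refine Finset.sum_le_sum fun j hj => ?_
      have hj' : (j : ℝ) ≤ N := by exact_mod_cast (Finset.mem_Icc.mp hj).2
      refine mul_le_mul_of_nonneg_left ?_ (by linarith)
      obtain ⟨m, hm⟩ := (Real.cos_eq_one_iff _).mp h
      rw [← hm, show (j : ℝ) * (m * (2 * Real.pi)) = ((j * m : ℤ) : ℝ) * (2 * Real.pi) by
        push_cast; ring, Real.cos_int_mul_two_pi]
      exact Real.cos_le_one _
    · change (1 - Real.cos (t - θ)) * ((N + 1) + 2 * F (t - θ)) = _ at hp
      change (1 - Real.cos (t + θ)) * ((N + 1) + 2 * F (t + θ)) = _ at hq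
      have hA : 0 ≤ (N + 1) + 2 * F (t - θ) := by
        by_contra hneg
        push Not at hneg
        nlinarith [mul_neg_of_pos_of_neg (sub_pos.mpr h) hneg]
      by_contra hlt
      push Not at hlt
      nlinarith [mul_pos (sub_pos.mpr (h.trans_le' hpq)) (sub_pos.mpr hlt),
        mul_nonneg (sub_nonneg.mpr hpq) hA]
  rw [hrep]
  have htan : 0 < Real.tan (Real.pi / (2 * ((N : ℝ) + 1))) :=
    Real.tan_pos_of_pos_of_lt_pi_div_two h0 h1
  exact mul_nonneg (by positivity) (by linarith)

/-! ### The perturbation and the limit -/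

theorem sum_perturbedCoeff_mul {N : ℕ} (hN : 1 ≤ N) (ε : ℝ) (f : ℕ → ℝ) :
    ∑ j ∈ Finset.Icc 1 N, perturbedCoeff N ε j * f j
      = (∑ j ∈ Finset.Icc 1 N, fejerCoeff N j * f j + ε * f 1) / (1 + ε) := by
  have h : ∀ j, perturbedCoeff N ε j * f j
      = fejerCoeff N j * f j / (1 + ε) + if j = 1 then ε * f 1 / (1 + ε) else 0 := by
    intro j
    rw [perturbedCoeff]
    split_ifs with hj
    · subst hj; ring
    · ring
  rw [Finset.sum_congr rfl fun j _ => h j, Finset.sum_add_distrib, Finset.sum_ite_eq',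
    if_pos (by simp [hN]), ← Finset.sum_div]
  ring

theorem sum_perturbedCoeff {N : ℕ} (hN : 1 ≤ N) {ε : ℝ} (hε : 0 < ε) :
    ∑ j ∈ Finset.Icc 1 N, perturbedCoeff N ε j = 1 := by
  have h := sum_perturbedCoeff_mul hN ε fun _ => 1
  simp only [mul_one, sum_fejerCoeff hN] at h
  rw [h, div_self (by positivity)]

/-- On (0, π) the term ε sin t makes the sine polynomial strictly positive, so only the endpoints
compete: the value is 1 at 0 and negative at π. -/
theorem rho_perturbedCoeff {N : ℕ} (hN : 1 ≤ N) {ε : ℝ} (hε : 0 < ε) :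
    rho N (perturbedCoeff N ε)
      = (-Real.tan (Real.pi / (2 * ((N : ℝ) + 1))) ^ 2 - ε) / (1 + ε) := by
  have hpi : cosPoly N (perturbedCoeff N ε) Real.pi
      = (-Real.tan (Real.pi / (2 * ((N : ℝ) + 1))) ^ 2 - ε) / (1 + ε) := by
    rw [cosPoly, sum_perturbedCoeff_mul hN ε fun j => Real.cos (j * Real.pi),
      ← cosPoly_fejerCoeff_pi hN, cosPoly]
    simp [sub_eq_add_neg]
  have hzero : cosPoly N (perturbedCoeff N ε) 0 = 1 := by
    simpa [cosPoly] using sum_perturbedCoeff hN hε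
  refine le_antisymm ?_ (le_csInf (realValues_nonempty _ _) ?_)
  · rw [← hpi]
    refine rho_le_cosPoly ⟨Real.pi_pos.le, le_rfl⟩ ?_
    simp [sinPoly, Real.sin_nat_mul_pi]
  · rintro x ⟨t, ht, hS, rfl⟩
    rw [sinPoly, sum_perturbedCoeff_mul hN ε fun j => Real.sin (j * t),
      div_eq_zero_iff, or_iff_left (by positivity)] at hS
    have h1 := sinPoly_fejerCoeff_nonneg hN ht
    have h2 := Real.sin_nonneg_of_mem_Icc ht
    rw [sinPoly] at h1
    simp only [Nat.cast_one, one_mul] at hS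
    have h3 : Real.sin t = 0 := by nlinarith
    rcases ht.1.eq_or_lt with rfl | h4
    · rw [hzero]
      refine (div_nonpos_of_nonpos_of_nonneg ?_ (by positivity)).trans zero_le_one
      nlinarith [sq_nonneg (Real.tan (Real.pi / (2 * ((N : ℝ) + 1))))]
    rcases ht.2.eq_or_lt with rfl | h5
    · exact hpi.ge
    · exact absurd h3 (Real.sin_pos_of_pos_of_lt_pi h4 h5).ne'

theorem tendsto_rho_perturbedCoeff {N : ℕ} (hN : 1 ≤ N) :
    Filter.Tendsto (fun ε : ℝ => rho N (perturbedCoeff N ε)) (nhdsWithin 0 (Set.Ioi 0))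
      (nhds (-Real.tan (Real.pi / (2 * ((N : ℝ) + 1))) ^ 2)) := by
  set τ := Real.tan (Real.pi / (2 * ((N : ℝ) + 1))) ^ 2 with hτ
  have hlim : Filter.Tendsto (fun ε : ℝ => (-τ - ε) / (1 + ε)) (nhdsWithin 0 (Set.Ioi 0))
      (nhds (-τ)) := by
    have hc : ContinuousAt (fun ε : ℝ => (-τ - ε) / (1 + ε)) 0 :=
      ContinuousAt.div (by fun_prop) (by fun_prop) (by norm_num)
    have h := hc.tendsto
    simp only [sub_zero, add_zero, div_one] at h
    exact h.mono_left nhdsWithin_le_nhds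
  refine hlim.congr' ?_
  filter_upwards [self_mem_nhdsWithin] with ε hε
  exact (rho_perturbedCoeff hN hε).symm

theorem theorem5 (N : ℕ) (hN : 1 ≤ N) :
    -1 / Real.cot (Real.pi / (2 * ((N : ℝ) + 1))) ^ 2
        = -Real.tan (Real.pi / (2 * ((N : ℝ) + 1))) ^ 2 ∧
    IsLUB {r : ℝ | ∃ a : ℕ → ℝ, ∑ j ∈ Finset.Icc 1 N, a j = 1 ∧ r = rho N a}
      (-1 / Real.cot (Real.pi / (2 * ((N : ℝ) + 1))) ^ 2) ∧
    (∀ ε : ℝ, 0 < ε → ∑ j ∈ Finset.Icc 1 N, perturbedCoeff N ε j = 1) ∧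
    Filter.Tendsto (fun ε : ℝ => rho N (perturbedCoeff N ε)) (nhdsWithin 0 (Set.Ioi 0))
      (nhds (-1 / Real.cot (Real.pi / (2 * ((N : ℝ) + 1))) ^ 2)) := by
  have hcot : -1 / Real.cot (Real.pi / (2 * ((N : ℝ) + 1))) ^ 2
      = -Real.tan (Real.pi / (2 * ((N : ℝ) + 1))) ^ 2 := by
    rw [← Real.tan_inv_eq_cot, inv_pow, div_inv_eq_mul, neg_one_mul]
  rw [hcot]
  have hlim := tendsto_rho_perturbedCoeff hN
  refine ⟨rfl, ⟨?_, fun b hb => ?_⟩, fun ε hε => sum_perturbedCoeff hN hε, hlim⟩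
  · rintro r ⟨a, ha, rfl⟩
    exact rho_le_neg_tan_sq hN ha
  · refine le_of_tendsto hlim ?_
    filter_upwards [self_mem_nhdsWithin] with ε hε
    exact hb ⟨_, sum_perturbedCoeff hN hε, rfl⟩
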